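/- Let $(T_t)_{t\ge 0}$ be a quantum dynamical semigroup (QDS) on $M_N(\mathbb C)$, i.e. a one-parameter semigroup of linear maps with $T_0=\mathrm{id}$, $T_{t+s}=T_tT_s$, $t\mapsto T_t(A)$ continuous for every $A$, and every $T_t$ completely positive and trace preserving. Let $\mathcal L(x)=\lim_{t\downarrow 0}\frac1t(T_t(x)-x)$ be its generator. Write $E_{ij}$ for the matrix units. By the Gorini--Kossakowski--Sudarshan--Lindblad theorem there are a unique traceless Hermitian matrix $H$ (the Hamiltonian of $\mathcal L$) and a unique $N^2\times N^2$ matrix $\Gamma=(\gamma_{ijk\ell})\ge 0$, regarded as an operator on $M_N(\mathbb C)$ via $\Gamma(E_{k\ell})=\sum_{i,j}\gamma_{ijk\ell}E_{ij}$, with $\Gamma(I)=0$ and $\operatorname{Tr}\Gamma(A)=0$ for all $A$, such that $$\mathcal L(\rho)=-i[H,\rho]+\tfrac12\sum_{i,j,k,\ell=1}^N\gamma_{ijk\ell}\bigl([E_{ij},\rho E_{k\ell}^*]+[E_{ij}\rho,E_{k\ell}^*]\bigr).$$ Let $G_{\mathcal L}$ be the weighted digraph on $\{1,\dots,N\}$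 in which, for $i\ne j$, the edge from $j$ to $i$ has weight $\gamma_{ij}:=\gamma_{ijij}\ge 0$ (no edge if the weight is $0$), and let $H_{\mathcal L}$ be the simple graph obtained from $G_{\mathcal L}$ by ignoring weights and directions. For a connected component $c$ of $H_{\mathcal L}$ with vertex set $V(c)$, let $P_c=\sum_{i\in V(c)}E_{ii}$. Suppose that $H$ is consistent with $H_{\mathcal L}$, i.e. $P_cHP_d=0$ for all distinct connected components $c\neq d$ of $H_{\mathcal L}$. Then the number of connected components of $H_{\mathcal L}$ satisfies $$cc(H_{\mathcal L})\le\dim_{\mathbb C}\ker\mathcal L.$$ Consequently, if $(T_t)$ is uniquely relaxing, i.e. there is a state $\rho_0$ (positive semidefinite of trace one) such that $T_t(\rho)\to\rho_0$ as $t\to\infty$ for every state $\rho$, then $H_{\mathcal L}$ is connected. -/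

import Mathlib

namespace QDS

open scoped ComplexOrder

/-- The algebra `M_N(ℂ)` of complex `N × N` matrices. -/
abbrev Mat (N : ℕ) : Type := Matrix (Fin N) (Fin N) ℂ

/-- The amplification `id_n ⊗ Φ` of `Φ`, acting on `n × n` block matrices with blocks in `M_N(ℂ)`
by applying `Φ` to every block. -/
def amplify {N : ℕ} (Φ : Mat N →ₗ[ℂ] Mat N) (n : ℕ)
    (X : Matrix (Fin n × Fin N) (Fin n × Fin N) ℂ) :
    Matrix (Fin n × Fin N) (Fin n × Fin N) ℂ :=
  Matrix.of fun p q => Φ (Matrix.of fun a b => X (p.1, a) (q.1, b)) p.2 q.2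

/-- `Φ` is completely positive: all its amplifications preserve positive semidefiniteness. -/
def IsCompletelyPositive {N : ℕ} (Φ : Mat N →ₗ[ℂ] Mat N) : Prop :=
  ∀ (n : ℕ) (X : Matrix (Fin n × Fin N) (Fin n × Fin N) ℂ),
    X.PosSemidef → (amplify Φ n X).PosSemidef

/-- A quantum dynamical semigroup on `M_N(ℂ)` (Schrödinger picture). -/
structure IsQDS {N : ℕ} (T : NNReal → Mat N →ₗ[ℂ] Mat N) : Prop where
  zero : T 0 = LinearMap.id
  add : ∀ t s, T (t + s) = T t ∘ₗ T s
  continuous : ∀ A, Continuous fun t => T t A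
  trace : ∀ t A, (T t A).trace = A.trace
  completelyPositive : ∀ t, IsCompletelyPositive (T t)

/-- `L` is the generator of `T`: `L x = lim_{t ↓ 0} (T_t x - x) / t` for every `x`. -/
def IsGenerator {N : ℕ} (T : NNReal → Mat N →ₗ[ℂ] Mat N) (L : Mat N →ₗ[ℂ] Mat N) : Prop :=
  ∀ x, Filter.Tendsto (fun t : NNReal => (t : ℝ)⁻¹ • (T t x - x))
    (nhdsWithin 0 (Set.Ioi 0)) (nhds (L x))

/-- A state: a positive semidefinite matrix of unit trace. -/
def IsState {N : ℕ} (ρ : Mat N) : Prop := ρ.PosSemidef ∧ ρ.trace = 1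

/-- `T` is uniquely relaxing: there is a state to which every initial state converges as
`t → ∞`. (Such a state is automatically unique and invariant.) -/
def IsUniquelyRelaxing {N : ℕ} (T : NNReal → Mat N →ₗ[ℂ] Mat N) : Prop :=
  ∃ ρ₀ : Mat N, IsState ρ₀ ∧
    ∀ ρ, IsState ρ → Filter.Tendsto (fun t => T t ρ) Filter.atTop (nhds ρ₀)

/-- Coefficient matrices `Γ = (γ_{ijkl})`, with rows and columns indexed by the standard basis
`E_{ij}` of `M_N(ℂ)`. -/
abbrev Coeff (N : ℕ) : Type := Matrix (Fin N × Fin N) (Fin N × Fin N) ℂ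

/-- `Γ` regarded as an operator on `M_N(ℂ)` with the standard basis:
`Γ(E_{kl}) = ∑_{ij} γ_{ijkl} E_{ij}`. -/
def coeffApply {N : ℕ} (Γ : Coeff N) (A : Mat N) : Mat N :=
  Matrix.of fun i j => ∑ k, ∑ l, Γ (i, j) (k, l) * A k l

/-- The standard basis matrix `E_{ij}`, `p = (i, j)`. -/
def E {N : ℕ} (p : Fin N × Fin N) : Mat N := Matrix.single p.1 p.2 1

open Matrix in
/-- `(H, Γ)` is the GKSL datum of `L` with respect to the standard basis: `H` is Hermitian and
traceless, `Γ ≥ 0`, `Γ(I) = 0`, `Γ` has traceless range, and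
`L ρ = -i[H, ρ] + (1/2) ∑_{p,q} γ_{pq} ([E_p, ρ E_q^*] + [E_p ρ, E_q^*])`.
Every generator of a quantum dynamical semigroup has exactly one such datum. -/
structure IsGKSL {N : ℕ} (L : Mat N →ₗ[ℂ] Mat N) (H : Mat N) (Γ : Coeff N) : Prop where
  isHermitian : H.IsHermitian
  trace_eq_zero : H.trace = 0
  posSemidef : Γ.PosSemidef
  apply_one : coeffApply Γ 1 = 0
  trace_apply : ∀ A, (coeffApply Γ A).trace = 0
  form : ∀ ρ, L ρ = -Complex.I • ⁅H, ρ⁆ +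
    (1 / 2 : ℂ) • ∑ p, ∑ q, Γ p q • (⁅E p, ρ * (E q)ᴴ⁆ + ⁅E p * ρ, (E q)ᴴ⁆)

/-- The GKSL datum `(H, Γ)` of `L` (meaningful when `L` generates a quantum dynamical
semigroup, in which case it exists and is unique). -/
noncomputable def gkslDatum {N : ℕ} (L : Mat N →ₗ[ℂ] Mat N) : Mat N × Coeff N :=
  Classical.epsilon fun p => IsGKSL L p.1 p.2

/-- The Hamiltonian `H` of `L`. -/
noncomputable def hamiltonian {N : ℕ} (L : Mat N →ₗ[ℂ] Mat N) : Mat N := (gkslDatum L).1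

/-- The coefficient matrix `Γ` of `L` in the standard basis. -/
noncomputable def coeffMatrix {N : ℕ} (L : Mat N →ₗ[ℂ] Mat N) : Coeff N := (gkslDatum L).2

/-- For `i ≠ j`, the weight `γ_{ij} = γ_{ijij}` of the edge from `j` to `i` in the weighted
digraph `G_L` induced by `L` (a nonnegative real; there is an edge when it is positive). -/
noncomputable def weight {N : ℕ} (L : Mat N →ₗ[ℂ] Mat N) (i j : Fin N) : ℝ :=
  (coeffMatrix L (i, j) (i, j)).re

/-- The graph `H_L` obtained from `G_L` by ignoring weights and directedness of the edges:
`i` and `j` are adjacent iff `i ≠ j` and `γ_{ij} > 0` or `γ_{ji} > 0`. -/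
noncomputable def inducedGraph {N : ℕ} (L : Mat N →ₗ[ℂ] Mat N) : SimpleGraph (Fin N) :=
  SimpleGraph.fromRel fun i j => 0 < weight L i j

open Classical in
/-- The orthogonal projection `P_c = ∑_{i ∈ V(c)} E_{ii}` belonging to a connected
component `c`. -/
noncomputable def componentProj {N : ℕ} (G : SimpleGraph (Fin N)) (c : G.ConnectedComponent) :
    Mat N :=
  Matrix.diagonal fun i => if G.connectedComponentMk i = c then 1 else 0

/-- The Hamiltonian of `L` is consistent with the induced graph `H_L`: `P_c H P_d = 0` for all
distinct connected components `c`, `d` of `H_L`. -/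
def IsConsistent {N : ℕ} (L : Mat N →ₗ[ℂ] Mat N) : Prop :=
  ∀ c d : (inducedGraph L).ConnectedComponent, c ≠ d →
    componentProj (inducedGraph L) c * hamiltonian L * componentProj (inducedGraph L) d = 0

end QDS

namespace QDS

open scoped ComplexOrder
open Matrix Filter Topology

variable {N : ℕ}

/-! Each `P_c` is conserved: `Tr (P_c L ρ) = 0` for all `ρ`. Since `Γ ≥ 0`, a nonzero `γ_{pq}`
forces `γ_{pp}, γ_{qq} ≠ 0`, so the `E_p` and `E_q` that occur never join different components and
commute with `P_c`; consistency says the same of `H` (`trace_componentProj_mul`). Thus the range of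
`L` lies in the kernel of the surjective `blockTrace`, and rank-nullity bounds the number of
components by `dim ker L`. Moreover `Tr (P_c T_t ρ)` is constant in `t`, so a common limit state
rules out two components. The datum `(H, Γ)` is chosen by `epsilon`, so its existence has to be
proved; uniqueness is not needed. -/

/-! ### Choi matrices and operator-sum forms -/

/-- The Choi matrix of `Φ`, i.e. its coefficients in
`Φ ρ = ∑_{p,q} C_{pq} E_p ρ E_q^*`. -/
def choi (Φ : Mat N →ₗ[ℂ] Mat N) : Coeff N :=
  Matrix.of fun p q => Φ (Matrix.single p.2 q.2 1) p.1 q.1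

/-- The map `ρ ↦ ∑_{p,q} C_{pq} E_p ρ E_q^*`. -/
noncomputable def sandwich (C : Coeff N) (ρ : Mat N) : Mat N :=
  ∑ p, ∑ q, C p q • (E p * ρ * (E q)ᴴ)

/-- The matrix with entries `a (i, j)`. -/
def unvec (a : Fin N × Fin N → ℂ) : Mat N := Matrix.of fun i j => a (i, j)

/-- The identity matrix as a vector. -/
def vecOne (N : ℕ) (p : Fin N × Fin N) : ℂ := if p.1 = p.2 then 1 else 0

theorem unvec_vecOne : unvec (vecOne N) = 1 := by
  ext i j
  simp [unvec, vecOne, Matrix.one_apply]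

theorem star_vecOne : star (vecOne N) = vecOne N := by
  ext p
  simp [vecOne, apply_ite]

theorem dotProduct_vecOne (a : Fin N × Fin N → ℂ) : a ⬝ᵥ vecOne N = (unvec a).trace := by
  simp [dotProduct, vecOne, Fintype.sum_prod_type, Matrix.trace, unvec]

theorem vecOne_dotProduct_self : vecOne N ⬝ᵥ vecOne N = N := by
  rw [dotProduct_vecOne, unvec_vecOne]
  simp

theorem sum_smul_E (a : Fin N × Fin N → ℂ) : ∑ p, a p • E p = unvec a := by
  ext i j
  simp [Fintype.sum_prod_type, E, unvec, Matrix.sum_apply, Matrix.single_apply, ite_and]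

theorem sandwich_apply (C : Coeff N) (ρ : Mat N) (i k : Fin N) :
    sandwich C ρ i k = ∑ j, ∑ l, C (i, j) (k, l) * ρ j l := by
  have h : ∀ p q : Fin N × Fin N, (E p * ρ * (E q)ᴴ) i k =
      if i = p.1 then (if k = q.1 then ρ p.2 q.2 else 0) else 0 := by
    rintro ⟨a, b⟩ ⟨c, d⟩
    simp only [E, Matrix.conjTranspose_single, star_one]
    by_cases h1 : i = a
    · subst h1
      by_cases h2 : k = c
      · subst h2
        simp
      · simp [h2]
    · simp [h1, Matrix.mul_assoc]
  simp only [sandwich, Matrix.sum_apply, Matrix.smul_apply, h, smul_eq_mul, Fintype.sum_prod_type]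
  rw [Finset.sum_eq_single i]
  · refine Finset.sum_congr rfl fun j _ => ?_
    rw [Finset.sum_eq_single k]
    · simp
    · intro b _ hb
      simp [hb.symm]
    · simp
  · intro b _ hb
    simp [hb.symm]
  · simp

theorem sandwich_choi (Φ : Mat N →ₗ[ℂ] Mat N) (ρ : Mat N) : sandwich (choi Φ) ρ = Φ ρ := by
  ext i k
  rw [sandwich_apply]
  conv_rhs => rw [Matrix.matrix_eq_sum_single ρ]
  have h : ∀ a b : Fin N, Matrix.single a b (ρ a b) = ρ a b • Matrix.single a b (1 : ℂ) := by
    intro a b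
    simp
  simp only [h, map_sum, map_smul, Matrix.sum_apply, Matrix.smul_apply, choi, Matrix.of_apply,
    smul_eq_mul, mul_comm]

theorem sandwich_add (C D : Coeff N) (ρ : Mat N) :
    sandwich (C + D) ρ = sandwich C ρ + sandwich D ρ := by
  simp [sandwich, add_smul, Finset.sum_add_distrib]

theorem sandwich_vecMulVec (a b : Fin N × Fin N → ℂ) (ρ : Mat N) :
    sandwich (vecMulVec a (star b)) ρ = unvec a * ρ * (unvec b)ᴴ := by
  rw [← sum_smul_E a, ← sum_smul_E b, sandwich, Matrix.conjTranspose_sum, Finset.sum_mul,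
    Finset.sum_mul_sum]
  refine Finset.sum_congr rfl fun p _ => Finset.sum_congr rfl fun q _ => ?_
  simp [vecMulVec_apply, smul_smul, mul_comm]

theorem choi_id : choi (LinearMap.id : Mat N →ₗ[ℂ] Mat N) =
    vecMulVec (vecOne N) (star (vecOne N)) := by
  ext ⟨i, j⟩ ⟨k, l⟩
  simp only [choi, LinearMap.id_apply, Matrix.of_apply, star_vecOne, vecMulVec_apply, vecOne,
    Matrix.single_apply, ← ite_and, mul_ite, mul_one, mul_zero]
  congr 1
  grind

/-- Amplify `Φ` on the rank-one matrix of the unnormalized maximally entangled vector `vecOne`.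
`Prod.swap` is needed because `amplify` puts the block index first. -/
theorem IsCompletelyPositive.choi_posSemidef {Φ : Mat N →ₗ[ℂ] Mat N}
    (h : IsCompletelyPositive Φ) : (choi Φ).PosSemidef := by
  have h1 := (h N _ (posSemidef_vecMulVec_self_star (vecOne N))).submatrix Prod.swap
  convert h1 using 1
  ext ⟨i, j⟩ ⟨k, l⟩
  simp only [choi, amplify, Matrix.of_apply, Matrix.submatrix_apply, Prod.swap]
  refine congrArg (fun B : Mat N => Φ B i k) ?_
  ext a b
  simp only [star_vecOne, vecMulVec_apply, vecOne, Matrix.of_apply,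
    Matrix.single_apply, ← ite_and, mul_ite, mul_one, mul_zero]
  congr 1
  grind

/-! ### Existence of the GKSL datum -/

theorem posSemidef_of_tendsto {ι n : Type*} [Fintype n] {l : Filter ι} [l.NeBot]
    {f : ι → Matrix n n ℂ} {A : Matrix n n ℂ} (hf : Tendsto f l (𝓝 A))
    (h : ∀ᶠ t in l, (f t).PosSemidef) : A.PosSemidef := by
  refine .of_dotProduct_mulVec_nonneg ?_ fun x => ?_
  · have h1 : Tendsto (fun t => (f t)ᴴ) l (𝓝 Aᴴ) :=
      (Continuous.matrix_conjTranspose continuous_id).continuousAt.tendsto.comp hf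
    exact tendsto_nhds_unique (h1.congr' (h.mono fun t ht => ht.isHermitian)) hf
  · have hc : Continuous fun B : Matrix n n ℂ => star x ⬝ᵥ B *ᵥ x := by fun_prop
    exact ge_of_tendsto ((hc.tendsto A).comp hf) (h.mono fun t ht => ht.dotProduct_mulVec_nonneg x)

theorem IsGenerator.tendsto_choi {T : NNReal → Mat N →ₗ[ℂ] Mat N} {L : Mat N →ₗ[ℂ] Mat N}
    (hL : IsGenerator T L) :
    Tendsto (fun t : NNReal => (t : ℝ)⁻¹ • (choi (T t) - vecMulVec (vecOne N) (star (vecOne N))))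
      (𝓝[>] 0) (𝓝 (choi L)) := by
  rw [← choi_id]
  refine tendsto_pi_nhds.2 fun p => tendsto_pi_nhds.2 fun q => ?_
  exact tendsto_pi_nhds.1 (tendsto_pi_nhds.1 (hL (Matrix.single p.2 q.2 1)) p.1) q.1

theorem IsGenerator.trace_eq_zero {T : NNReal → Mat N →ₗ[ℂ] Mat N} {L : Mat N →ₗ[ℂ] Mat N}
    (hT : IsQDS T) (hL : IsGenerator T L) (ρ : Mat N) : (L ρ).trace = 0 := by
  have hc : Continuous fun B : Mat N => B.trace := by fun_prop
  refine tendsto_nhds_unique ((hc.tendsto _).comp (hL ρ)) (tendsto_const_nhds.congr fun t => ?_)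
  simp [Matrix.trace_smul, Matrix.trace_sub, hT.trace]

/-- Rewrites the dissipator as a sandwich minus half an anticommutator, the shape that the Choi
matrix of `L` yields. -/
theorem sum_smul_lie (Γ : Coeff N) (ρ : Mat N) :
    (1 / 2 : ℂ) • ∑ p, ∑ q, Γ p q • (⁅E p, ρ * (E q)ᴴ⁆ + ⁅E p * ρ, (E q)ᴴ⁆) =
      sandwich Γ ρ - (1 / 2 : ℂ) • (ρ * (∑ p, ∑ q, Γ p q • ((E q)ᴴ * E p)) +
        (∑ p, ∑ q, Γ p q • ((E q)ᴴ * E p)) * ρ) := by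
  simp only [sandwich, Finset.mul_sum, Finset.sum_mul, ← Finset.sum_add_distrib,
    Finset.smul_sum, ← Finset.sum_sub_distrib, Ring.lie_def]
  refine Finset.sum_congr rfl fun p _ => Finset.sum_congr rfl fun q _ => ?_
  simp only [mul_assoc, Matrix.mul_smul, Matrix.smul_mul]
  module

theorem trace_sandwich (Γ : Coeff N) (ρ : Mat N) :
    (sandwich Γ ρ).trace = ((∑ p, ∑ q, Γ p q • ((E q)ᴴ * E p)) * ρ).trace := by
  simp only [sandwich, Finset.sum_mul, Matrix.trace_sum, Matrix.smul_mul, Matrix.trace_smul]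
  refine Finset.sum_congr rfl fun p _ => Finset.sum_congr rfl fun q _ => ?_
  rw [Matrix.trace_mul_comm, mul_assoc]

theorem coeffApply_eq_unvec (Γ : Coeff N) (A : Mat N) :
    coeffApply Γ A = unvec (Γ *ᵥ fun p => A p.1 p.2) := by
  ext i j
  simp [coeffApply, unvec, mulVec, dotProduct, Fintype.sum_prod_type]

/-- Existence in the Gorini–Kossakowski–Sudarshan–Lindblad theorem. -/
theorem IsGenerator.exists_isGKSL {T : NNReal → Mat N →ₗ[ℂ] Mat N} {L : Mat N →ₗ[ℂ] Mat N}
    (hT : IsQDS T) (hL : IsGenerator T L) : ∃ H Γ, IsGKSL L H Γ := by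
  rcases Nat.eq_zero_or_pos N with rfl | hN
  · exact ⟨0, 0, by simp, by simp, .zero, Subsingleton.elim _ _,
      fun A => by simp [Matrix.trace], fun ρ => Subsingleton.elim _ _⟩
  have hN' : (N : ℂ) ≠ 0 := by exact_mod_cast hN.ne'
  set v := vecOne N with hv
  set M := choi L with hM
  -- `P` projects onto the line of the identity matrix, `Q` onto the traceless matrices.
  set P : Coeff N := (N : ℂ)⁻¹ • vecMulVec v (star v) with hP
  set Q : Coeff N := 1 - P with hQ
  have hPH : Pᴴ = P := by
    simp [hP, conjTranspose_smul, conjTranspose_vecMulVec]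
  have hQH : Qᴴ = Q := by simp [hQ, hPH]
  have hQv : Q *ᵥ v = 0 := by
    rw [hQ, sub_mulVec, one_mulVec, hP, smul_mulVec, vecMulVec_mulVec, hv, star_vecOne,
      vecOne_dotProduct_self]
    ext p
    simp [mul_left_comm _ (vecOne N p), hN']
  have hvQ : star v ᵥ* Q = 0 := by
    rw [← hQH, ← star_mulVec, hQv, star_zero]
  have hlim := hL.tendsto_choi
  have hMH : Mᴴ = M := by
    have h1 : Tendsto (fun t : NNReal => ((t : ℝ)⁻¹ • (choi (T t) - vecMulVec v (star v)))ᴴ)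
        (𝓝[>] 0) (𝓝 Mᴴ) :=
      (Continuous.matrix_conjTranspose continuous_id).continuousAt.tendsto.comp hlim
    refine tendsto_nhds_unique (h1.congr fun t => ?_) hlim
    rw [conjTranspose_smul, conjTranspose_sub, (hT.completelyPositive t).choi_posSemidef.1.eq,
      conjTranspose_vecMulVec]
    simp [hv]
  -- `M` itself need not be positive, but compression by `Q` kills the term of `T 0 = id` in the
  -- difference quotients.
  have hΓ : (Q * M * Q).PosSemidef := by
    have hc : Continuous fun B : Coeff N => Q * B * Q := by fun_prop
    refine posSemidef_of_tendsto ((hc.tendsto _).comp hlim) (.of_forall fun t => ?_)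
    have h1 := ((hT.completelyPositive t).choi_posSemidef.mul_mul_conjTranspose_same Q).smul
      (a := (t : ℝ)⁻¹) (by positivity)
    rw [hQH] at h1
    convert h1 using 1
    simp [mul_sub, mul_vecMulVec, hQv, ← hv]
  -- The factor `1 / 2` splits `P M P` evenly, so that `X P + P Xᴴ = M P + P M - P M P = M - Q M Q`.
  set X : Coeff N := M - (1 / 2 : ℂ) • (P * M) with hX
  set c := (N : ℂ)⁻¹ • (X *ᵥ v) with hc
  set A := unvec c with hA
  have hcv : vecMulVec c (star v) = X * P := by
    rw [hc, hP, Matrix.mul_smul, mul_vecMulVec, smul_vecMulVec]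
  have hvc : vecMulVec v (star c) = P * Xᴴ := by
    rw [← hPH, ← conjTranspose_mul, ← hcv, conjTranspose_vecMulVec, star_star]
  have hdec : M = Q * M * Q + (vecMulVec c (star v) + vecMulVec v (star c)) := by
    rw [hcv, hvc, hX, conjTranspose_sub, conjTranspose_smul, conjTranspose_mul, hMH, hPH, hQ]
    have : star (1 / 2 : ℂ) = 1 / 2 := by simp
    rw [this]
    simp only [sub_mul, mul_sub, one_mul, mul_one, Matrix.mul_smul, Matrix.smul_mul, mul_assoc]
    module
  have hLform : ∀ ρ, L ρ = sandwich (Q * M * Q) ρ + (A * ρ + ρ * Aᴴ) := by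
    intro ρ
    rw [← sandwich_choi L, ← hM]
    conv_lhs => rw [hdec]
    rw [sandwich_add, sandwich_add, sandwich_vecMulVec, sandwich_vecMulVec, hv, unvec_vecOne]
    simp [hA]
  set K := ∑ p, ∑ q, (Q * M * Q) p q • ((E q)ᴴ * E p) with hK
  -- Trace preservation fixes the Hermitian part of `A`.
  have hKA : K = -(A + Aᴴ) := by
    rw [eq_neg_iff_add_eq_zero, Matrix.ext_iff_trace_mul_right]
    intro ρ
    have h1 := IsGenerator.trace_eq_zero hT hL ρ
    rw [hLform, Matrix.trace_add, trace_sandwich, ← hK, Matrix.trace_add,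
      Matrix.trace_mul_comm ρ] at h1
    simpa [add_mul] using h1
  -- Chosen so that `A = -K / 2 - i H₀`; removing the trace later does not affect the commutator.
  set H₀ : Mat N := (Complex.I / 2) • (A - Aᴴ) with hH₀
  have hH₀H : H₀ᴴ = H₀ := by
    rw [hH₀, conjTranspose_smul, conjTranspose_sub, conjTranspose_conjTranspose]
    have : star (Complex.I / 2) = -(Complex.I / 2) := by simp [neg_div]
    rw [this]
    module
  refine ⟨H₀ - (H₀.trace / N) • 1, Q * M * Q, ?_, ?_, hΓ, ?_, ?_, ?_⟩
  · have h1 : star H₀.trace = H₀.trace := by rw [← trace_conjTranspose, hH₀H]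
    rw [Matrix.IsHermitian, conjTranspose_sub, hH₀H, conjTranspose_smul, conjTranspose_one,
      star_div₀, h1]
    simp
  · simp [hN']
  · rw [coeffApply_eq_unvec]
    have : (fun p : Fin N × Fin N => (1 : Mat N) p.1 p.2) = v := by
      ext p
      simp [hv, vecOne, Matrix.one_apply]
    rw [this, ← mulVec_mulVec, hQv, mulVec_zero]
    ext
    simp [unvec]
  · intro B
    rw [coeffApply_eq_unvec, ← dotProduct_vecOne, ← star_vecOne, dotProduct_comm, mul_assoc,
      ← mulVec_mulVec, dotProduct_mulVec, ← hv, hvQ, zero_dotProduct]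
  · intro ρ
    rw [sum_smul_lie, ← hK, hKA, hLform, Ring.lie_def, hH₀]
    have hI : Complex.I * (Complex.I / 2) = -(1 / 2) := by
      rw [← mul_div_assoc, Complex.I_mul_I]; ring
    simp only [sub_mul, mul_sub, Matrix.smul_mul, Matrix.mul_smul, one_mul, mul_one, smul_sub,
      smul_smul, neg_mul, hI, mul_neg, mul_add, add_mul, smul_add]
    module

theorem IsGenerator.isGKSL {T : NNReal → Mat N →ₗ[ℂ] Mat N} {L : Mat N →ₗ[ℂ] Mat N}
    (hT : IsQDS T) (hL : IsGenerator T L) : IsGKSL L (hamiltonian L) (coeffMatrix L) := by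
  obtain ⟨H, Γ, h⟩ := IsGenerator.exists_isGKSL hT hL
  exact Classical.epsilon_spec (p := fun p : Mat N × Coeff N => IsGKSL L p.1 p.2) ⟨(H, Γ), h⟩

/-! ### Conservation of the component projections -/

theorem PosSemidef.apply_eq_zero_of_diag {n : Type*} [Fintype n] [DecidableEq n]
    {Γ : Matrix n n ℂ} (h : Γ.PosSemidef) {p : n} (hp : Γ p p = 0) (q : n) :
    Γ q p = 0 ∧ Γ p q = 0 := by
  have h1 : Γ *ᵥ Pi.single p 1 = 0 := by
    rw [← h.dotProduct_mulVec_zero_iff]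
    simp [hp]
  have h2 : Γ q p = 0 := by simpa using congrFun h1 q
  refine ⟨h2, ?_⟩
  rw [← h.1.apply, h2, star_zero]

/-- If `P` commutes with the Hamiltonian and the Lindblad operators, it is a fixed point in the
Heisenberg picture. -/
theorem IsGKSL.trace_mul_eq_zero {L : Mat N →ₗ[ℂ] Mat N} {H : Mat N} {Γ : Coeff N}
    (h : IsGKSL L H Γ) {P : Mat N} (hH : Commute P H)
    (hΓ : ∀ p q, Γ p q ≠ 0 → Commute P (E p) ∧ Commute P (E q)ᴴ) (ρ : Mat N) :
    (P * L ρ).trace = 0 := by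
  -- By cyclicity `P` annihilates commutators with `F` under the trace; every term of `L ρ` is one,
  -- with `F` equal to `H`, `E p` or `(E q)ᴴ`.
  have key : ∀ F ρ : Mat N, Commute P F → (P * (F * ρ)).trace = (P * (ρ * F)).trace := by
    intro F ρ hF
    rw [← mul_assoc, hF.eq, mul_assoc, Matrix.trace_mul_comm, mul_assoc]
  have h1 : ∀ p q, Γ p q • (P * (⁅E p, ρ * (E q)ᴴ⁆ + ⁅E p * ρ, (E q)ᴴ⁆)).trace = 0 := by
    intro p q
    by_cases hpq : Γ p q = 0
    · simp [hpq]
    · obtain ⟨hp, hq⟩ := hΓ p q hpq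
      simp only [Ring.lie_def, mul_add, mul_sub, Matrix.trace_add, Matrix.trace_sub]
      rw [key _ (ρ * (E q)ᴴ) hp, key _ (E p * ρ) hq]
      simp
  rw [h.form, mul_add, Matrix.trace_add, Matrix.mul_smul, Matrix.trace_smul, Ring.lie_def, mul_sub,
    Matrix.trace_sub, key H ρ hH, Matrix.mul_smul, Matrix.trace_smul]
  simp only [Finset.mul_sum, Matrix.trace_sum, Matrix.mul_smul, Matrix.trace_smul, h1]
  simp

theorem commute_diagonal {d : Fin N → ℂ} {A : Mat N} (h : ∀ i j, A i j ≠ 0 → d i = d j) :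
    Commute (Matrix.diagonal d) A := by
  ext i j
  rw [Matrix.diagonal_mul, Matrix.mul_diagonal]
  by_cases hA : A i j = 0
  · simp [hA]
  · rw [h i j hA, mul_comm]

theorem eq_of_single_apply_ne_zero {a b i j : Fin N} (h : Matrix.single a b (1 : ℂ) i j ≠ 0) :
    a = i ∧ b = j := by
  by_contra hne
  exact h (by rw [Matrix.single_apply, if_neg hne])

theorem componentProj_mul_mul_apply {G : SimpleGraph (Fin N)} (A : Mat N) (i j : Fin N) :
    (componentProj G (G.connectedComponentMk i) * A *
      componentProj G (G.connectedComponentMk j)) i j = A i j := by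
  simp [componentProj, Matrix.diagonal_mul, Matrix.mul_diagonal]

theorem IsGenerator.trace_componentProj_mul {T : NNReal → Mat N →ₗ[ℂ] Mat N}
    {L : Mat N →ₗ[ℂ] Mat N} (hT : IsQDS T) (hL : IsGenerator T L) (hcons : IsConsistent L)
    (c : (inducedGraph L).ConnectedComponent) (ρ : Mat N) :
    (componentProj (inducedGraph L) c * L ρ).trace = 0 := by
  have h := IsGenerator.isGKSL hT hL
  have hcomp : ∀ p, coeffMatrix L p p ≠ 0 →
      (inducedGraph L).connectedComponentMk p.1 = (inducedGraph L).connectedComponentMk p.2 := by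
    rintro ⟨i, j⟩ hp
    by_cases hij : i = j
    · rw [hij]
    · refine SimpleGraph.ConnectedComponent.sound (SimpleGraph.Adj.reachable ?_)
      rw [inducedGraph, SimpleGraph.fromRel_adj]
      refine ⟨hij, Or.inl ?_⟩
      exact (Complex.pos_iff.1 (lt_of_le_of_ne h.posSemidef.diag_nonneg hp.symm)).1
  refine h.trace_mul_eq_zero (commute_diagonal fun i j hij => ?_) (fun p q hpq => ⟨?_, ?_⟩) ρ
  · have : (inducedGraph L).connectedComponentMk i = (inducedGraph L).connectedComponentMk j := by
      by_contra hne
      apply hij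
      rw [← componentProj_mul_mul_apply (G := inducedGraph L) (hamiltonian L) i j, hcons _ _ hne,
        Matrix.zero_apply]
    rw [this]
  · have hp := hcomp p fun h0 => hpq (PosSemidef.apply_eq_zero_of_diag h.posSemidef h0 q).2
    refine commute_diagonal fun i j hij => ?_
    obtain ⟨rfl, rfl⟩ := eq_of_single_apply_ne_zero hij
    rw [hp]
  · have hq := hcomp q fun h0 => hpq (PosSemidef.apply_eq_zero_of_diag h.posSemidef h0 p).1
    refine commute_diagonal fun i j hij => ?_
    rw [E, Matrix.conjTranspose_single] at hij
    rw [star_one] at hij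
    obtain ⟨rfl, rfl⟩ := eq_of_single_apply_ne_zero hij
    rw [hq]

/-! ### Block traces and the dimension bound -/

open Classical in
theorem trace_componentProj_mul_single (G : SimpleGraph (Fin N)) (c : G.ConnectedComponent)
    (i : Fin N) : (componentProj G c * Matrix.single i i 1).trace =
      if G.connectedComponentMk i = c then 1 else 0 := by
  simp [componentProj, Matrix.trace, Matrix.diagonal_mul, Matrix.single_apply]

/-- The vector of block traces of a matrix, over the connected components of a graph. -/
noncomputable def blockTrace (G : SimpleGraph (Fin N)) :
    Mat N →ₗ[ℂ] (G.ConnectedComponent → ℂ) :=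
  LinearMap.pi fun c => Matrix.traceLinearMap (Fin N) ℂ ℂ ∘ₗ
    LinearMap.mulLeft ℂ (componentProj G c)

/-- The matrix unit `E_ii` maps to the basis vector of the component of `i`. -/
theorem blockTrace_surjective (G : SimpleGraph (Fin N)) :
    Function.Surjective (blockTrace G) := by
  classical
  rw [← LinearMap.range_eq_top, eq_top_iff, ← (Pi.basisFun ℂ G.ConnectedComponent).span_eq,
    Submodule.span_le]
  rintro _ ⟨c, rfl⟩
  induction c using SimpleGraph.ConnectedComponent.ind with | _ i
  refine ⟨Matrix.single i i 1, ?_⟩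
  ext d
  have := trace_componentProj_mul_single G d i
  simp only [blockTrace, LinearMap.pi_apply, LinearMap.comp_apply, LinearMap.mulLeft_apply,
    Matrix.traceLinearMap_apply, this, Pi.basisFun_apply, Pi.single_apply, eq_comm]

/-- The range of `L` lies in `ker f`, of codimension `Nat.card ι`, so the rank of `L` drops by at
least that much. -/
theorem card_le_finrank_ker {V : Type*} [AddCommGroup V] [Module ℂ V] [FiniteDimensional ℂ V]
    {ι : Type*} [Finite ι] (L : V →ₗ[ℂ] V) (f : V →ₗ[ℂ] (ι → ℂ)) (hf : Function.Surjective f)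
    (hfL : ∀ x, f (L x) = 0) : Nat.card ι ≤ Module.finrank ℂ (LinearMap.ker L) := by
  have := Fintype.ofFinite ι
  have h1 := L.finrank_range_add_finrank_ker
  have h2 := f.finrank_range_add_finrank_ker
  rw [LinearMap.range_eq_top.2 hf, finrank_top, Module.finrank_fintype_fun_eq_card] at h2
  have h3 : Module.finrank ℂ (LinearMap.range L) ≤ Module.finrank ℂ (LinearMap.ker f) :=
    Submodule.finrank_mono (LinearMap.range_le_ker_iff.2 (LinearMap.ext hfL))
  rw [Nat.card_eq_fintype_card]
  omega

/-! ### Conservation along the semigroup and relaxation -/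

/-- Fixed points of the Heisenberg generator are conserved by the semigroup. -/
theorem IsGenerator.trace_mul_const {T : NNReal → Mat N →ₗ[ℂ] Mat N} {L : Mat N →ₗ[ℂ] Mat N}
    (hT : IsQDS T) (hL : IsGenerator T L) {P : Mat N} (hP : ∀ ρ, (P * L ρ).trace = 0)
    (ρ : Mat N) (t : NNReal) : (P * T t ρ).trace = (P * ρ).trace := by
  have hc : Continuous fun B : Mat N => (P * B).trace := by fun_prop
  set f : ℝ → ℂ := fun s => (P * T s.toNNReal ρ).trace with hf
  have hfc : Continuous f := hc.comp ((hT.continuous ρ).comp continuous_real_toNNReal)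
  -- The generator is a one-sided limit, so only right derivatives are at hand; with continuity they
  -- suffice. At `s` the derivative is `Tr (P L (T_s ρ)) = 0`.
  have hd : ∀ s ∈ Set.Ico (0 : ℝ) t, HasDerivWithinAt f 0 (Set.Ici s) s := by
    intro s hs
    rw [hasDerivWithinAt_iff_tendsto_slope, Set.Ici_sdiff_left]
    have h1 : Tendsto (fun r : ℝ => (r - s).toNNReal) (𝓝[>] s) (𝓝[>] 0) := by
      refine tendsto_nhdsWithin_iff.2 ⟨?_, ?_⟩
      · have : Continuous fun r : ℝ => (r - s).toNNReal := by fun_prop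
        simpa using (this.tendsto s).mono_left nhdsWithin_le_nhds
      · filter_upwards [self_mem_nhdsWithin] with r hr
        simpa using hr
    have h2 := ((hc.tendsto _).comp (hL (T s.toNNReal ρ))).comp h1
    rw [hP] at h2
    refine h2.congr' ?_
    filter_upwards [self_mem_nhdsWithin] with r hr
    have hr' : s < r := hr
    have h3 : r.toNNReal = (r - s).toNNReal + s.toNNReal := by
      rw [← Real.toNNReal_add (sub_nonneg.2 hr'.le) hs.1, sub_add_cancel]
    simp only [Function.comp_apply, slope_def_module, hf]
    rw [h3, hT.add, Real.coe_toNNReal _ (sub_nonneg.2 hr'.le)]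
    simp [mul_sub, Matrix.trace_sub]
  have := constant_of_has_deriv_right_zero hfc.continuousOn hd t ⟨t.2, le_rfl⟩
  simpa [hf, hT.zero] using this

theorem isState_single (i : Fin N) : IsState (Matrix.single i i (1 : ℂ)) := by
  refine ⟨?_, by simp⟩
  rw [← Matrix.diagonal_single]
  exact .diagonal (Pi.single_nonneg.2 zero_le_one)

end QDS

theorem mainTheorem11 {N : ℕ} (T : NNReal → QDS.Mat N →ₗ[ℂ] QDS.Mat N)
    (L : QDS.Mat N →ₗ[ℂ] QDS.Mat N) (hT : QDS.IsQDS T) (hL : QDS.IsGenerator T L)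
    (hcons : QDS.IsConsistent L) :
    Nat.card (QDS.inducedGraph L).ConnectedComponent ≤
        Module.finrank ℂ (LinearMap.ker L) ∧
      (QDS.IsUniquelyRelaxing T → (QDS.inducedGraph L).Connected) := by
  have htr := QDS.IsGenerator.trace_componentProj_mul hT hL hcons
  refine ⟨QDS.card_le_finrank_ker L (QDS.blockTrace (QDS.inducedGraph L))
    (QDS.blockTrace_surjective _) fun x => funext fun c => htr c x, ?_⟩
  rintro ⟨ρ₀, hρ₀, hlim⟩
  -- The left side is the indicator of `i ∈ V(c)`, the right side does not depend on `i`; hence all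
  -- vertices share one component.
  have hval : ∀ c i, (QDS.componentProj (QDS.inducedGraph L) c * Matrix.single i i 1).trace =
      (QDS.componentProj (QDS.inducedGraph L) c * ρ₀).trace := by
    intro c i
    have hc : Continuous fun B : QDS.Mat N =>
        (QDS.componentProj (QDS.inducedGraph L) c * B).trace := by fun_prop
    refine tendsto_nhds_unique (tendsto_const_nhds.congr fun t => ?_)
      ((hc.tendsto _).comp (hlim _ (QDS.isState_single i)))
    exact (QDS.IsGenerator.trace_mul_const hT hL (htr c) _ t).symm
  refine (SimpleGraph.connected_iff _).2 ⟨fun i j => ?_, ?_⟩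
  · have h := (hval ((QDS.inducedGraph L).connectedComponentMk i) i).trans
      (hval ((QDS.inducedGraph L).connectedComponentMk i) j).symm
    rw [QDS.trace_componentProj_mul_single, QDS.trace_componentProj_mul_single] at h
    by_contra hne
    rw [if_pos rfl, if_neg] at h
    · exact one_ne_zero h
    · exact fun he => hne (SimpleGraph.ConnectedComponent.exact he).symm
  -- `Connected` includes nonemptiness: for `N = 0` no matrix has trace one.
  · by_contra hemp
    rw [not_nonempty_iff] at hemp
    have h := hρ₀.2
    simp [Matrix.trace] at h
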